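/- Let $X_0, X_1, \dots$ be i.i.d. nonnegative random variables with $\mathbb{E}[X^2] < \infty$ and CDF $F_X$, where $X_t$ is the energy harvested in slot $t$ by a transmitter with a battery of size $B_{\max}$ and initial charge $b_0 \in [0, B_{\max}]$. Let the channel power gains $h_0, h_1, \dots$ be i.i.d. exponential random variables with mean $1$, independent of the arrivals. If energy $P_t$ is used in slot $t$, the rate is $r_t = \frac12 \log(1 + h_t P_t)$, where $\log$ is to base $2$. The battery level evolves by $B_0 = \min(b_0 + X_0, B_{\max})$ and $B_{t+1} = \min(B_t - P_t + X_{t+1}, B_{\max})$, and a policy is feasible if $0 \le P_t \le B_t$ for all $t$. Let $\delta = F_X^{-1}(0.5)$, i.e. $F_X(\delta) = 0.5$, and suppose that $0 < \delta \le B_{\max}$. The Constant Fraction Policy treats the arrivals as Bernoulli$(0.5)$ packets of size $\delta$, a packet arriving in slot $t$ if and only if $X_t > \delta$: it uses $P_t = \frac12 \left(\frac12\right)^{j} \delta$, where $j = t - \max\{t' \le t : X_{t'} > \delta\}$ is the number of slots since the last packet, and $P_t = 0$ before the first packet. Then almost surely this policy is feasible, and it remains feasible if $X_t$ is replaced in the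 recursion for the battery level by the energy of the packet alone ($\delta$ if $X_t > \delta$, and $0$ otherwise). Its long-term throughput exists: there is a constant $T_{lb}$ such that $\frac1N \sum_{t=0}^{N-1} r_t \to T_{lb}$ almost surely and $\mathbb{E}\left[\frac1N \sum_{t=0}^{N-1} r_t\right] \to T_{lb}$ as $N \to \infty$. With $T_{ub} = \frac12 \log\left(1 + \sqrt2 \sqrt{\mathbb{E}[X^2]}\right)$, $$T_{lb} \ge T_{ub} - 1.67 - \frac14 \log\left(\frac{\mathbb{E}[X^2]}{\left(F_X^{-1}(0.5)\right)^2}\right).$$ -/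

import Mathlib

open MeasureTheory ProbabilityTheory Filter Topology

noncomputable section

namespace EnergyHarvesting

/-- Battery level available for transmission in slot `t`, for a battery of capacity `cap` with
initial charge `b₀`, harvested energies `E` and consumed energies `P`. The energy `E t` may be used
from slot `t` on, and energy exceeding the capacity is lost. -/
def battery (cap b₀ : ℝ) (E P : ℕ → ℝ) : ℕ → ℝ
  | 0 => min (b₀ + E 0) cap
  | t + 1 => min (battery cap b₀ E P t - P t + E (t + 1)) cap

/-- Energy neutrality: in every slot the consumed energy is nonnegative and does not exceed
the battery level. -/
def EnergyNeutral (cap b₀ : ℝ) (E P : ℕ → ℝ) : Prop :=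
  ∀ t, 0 ≤ P t ∧ P t ≤ battery cap b₀ E P t

open Classical in
/-- Constant Fraction Policy for Bernoulli(`p`) arrivals `E` of packets of size `b`
(the size being also the battery size the policy works with):
in slot `t` it uses `p * (1 - p) ^ j * b`, where `j = t - max {t' ≤ t | E t' = b}`;
it is silent before the first packet. -/
def cfpPower (p b : ℝ) (E : ℕ → ℝ) (t : ℕ) : ℝ :=
  if ∃ t' ≤ t, E t' = b then
    p * (1 - p) ^ (t - Nat.findGreatest (fun t' => E t' = b) t) * b
  else 0

/-- Two-level version of an arrival: a packet of size `δ` if the arrival exceeds `δ`,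
and no energy otherwise. -/
def packet (δ x : ℝ) : ℝ := if δ < x then δ else 0

/-- Constant Fraction Policy for general arrivals `x`: the arrivals are treated as
Bernoulli(1/2) packets of size `δ`. -/
def medianCFP (δ : ℝ) (x : ℕ → ℝ) (t : ℕ) : ℝ :=
  cfpPower (1 / 2) δ (fun s => packet δ (x s)) t

/-- Rate, in bits, for channel (power) gain `g` and transmit energy `P`. -/
def rate (g P : ℝ) : ℝ := 1 / 2 * Real.logb 2 (1 + g * P)

/-- `T` is the long-term throughput of the random rates `r`: the time averages converge to the
number `T` almost surely, and so do their (finite) expectations. -/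
structure IsThroughput {Ω : Type*} [MeasurableSpace Ω] (μ : Measure Ω) (r : ℕ → Ω → ℝ)
    (T : ℝ) : Prop where
  ae_tendsto : ∀ᵐ ω ∂μ,
    Tendsto (fun N : ℕ => (1 / (N : ℝ)) * ∑ t ∈ Finset.range N, r t ω) atTop (𝓝 T)
  integrable : ∀ t, Integrable (r t) μ
  tendsto_expectation :
    Tendsto (fun N : ℕ => ∫ ω, (1 / (N : ℝ)) * ∑ t ∈ Finset.range N, r t ω ∂μ) atTop (𝓝 T)

/-- The quantity `T_ub`, as a function of the second moment of the arrivals. -/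
def throughputUB (secondMoment : ℝ) : ℝ :=
  1 / 2 * Real.logb 2 (1 + √2 * √secondMoment)

end EnergyHarvesting

end

/-!
Let `T` be the time since the last packet. In the stationary regime `T = j` has probability
`2 ^ (-(j + 1))`, and the policy then uses energy `2 ^ (-(j + 1)) δ`, so the throughput is
`∑ j, 2 ^ (-(j + 1)) * meanRate (2 ^ (-(j + 1)) δ)`, where `meanRate` averages the rate over the
exponential gain.

* Feasibility (`two_mul_medianCFP_le_battery`): the policy always uses half of what is left of the
  last packet, and the battery holds at least that remainder.
* Existence of the throughput (`isThroughput_medianCFP`): the rate in slot `t` is the sum over `j`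
  of the `gapRate`s of the packets that arrived in slot `t - j` and were followed by `j` slots
  without a packet. For fixed `j` these depend on windows of `j + 1` slots, so the strong law
  applies along each residue class modulo `j + 1` (`ae_tendsto_average_gapRate`). The sum over `j`
  is exchanged with the limit by Tannery's theorem (`tendsto_average_sum_range`), the terms being
  dominated by a geometric series times the average gain.
* Lower bound (`le_tsum_gap_meanRate`): by concavity of the logarithm, fading costs at most
  `-E[log h] = γ` nats in `2 * meanRate`, that is at most `0.42` bits of rate, and the decay of the
  energy at most `1` bit. Hence the throughput is at least `½ log (1 + δ) - 1.42`.
* Comparison with `T_ub` (`throughputUB_le`): Chebyshev's inequality at the median gives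
  `δ ≤ √2 √E[X²]`, and monotonicity of `u ↦ (1 + u) / u` turns the previous bound into the claim,
  with the remaining `¼` bit equal to `½ log √2`.
-/

namespace EnergyHarvesting

/-! ### The standard exponential distribution -/

theorem expMeasure_one_eq : expMeasure 1 =
    (volume.restrict (Set.Ioi 0)).withDensity fun x : ℝ => ENNReal.ofReal (Real.exp (-x)) := by
  have hpdf : gammaPDF 1 1 =
      (Set.Ici (0 : ℝ)).indicator fun x => ENNReal.ofReal (Real.exp (-x)) := by
    funext x
    by_cases hx : 0 ≤ x
    · rw [gammaPDF_of_nonneg hx, Set.indicator_of_mem (Set.mem_Ici.2 hx)]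
      simp
    · rw [gammaPDF_of_neg (not_le.1 hx), Set.indicator_of_notMem (by simpa using hx)]
  rw [expMeasure, gammaMeasure, hpdf, withDensity_indicator measurableSet_Ici,
    Measure.restrict_congr_set Ioi_ae_eq_Ici]

theorem integral_expMeasure_one (f : ℝ → ℝ) :
    ∫ x, f x ∂expMeasure 1 = ∫ x in Set.Ioi 0, Real.exp (-x) * f x := by
  rw [expMeasure_one_eq, integral_withDensity_eq_integral_toReal_smul (by fun_prop) (by simp)]
  simp [ENNReal.toReal_ofReal, Real.exp_nonneg]

theorem integrable_expMeasure_one_iff (f : ℝ → ℝ) :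
    Integrable f (expMeasure 1) ↔
      IntegrableOn (fun x => Real.exp (-x) * f x) (Set.Ioi 0) := by
  rw [expMeasure_one_eq, integrable_withDensity_iff_integrable_smul' (by fun_prop) (by simp)]
  simp [ENNReal.toReal_ofReal, Real.exp_nonneg, IntegrableOn]

theorem ae_pos_expMeasure_one : ∀ᵐ x ∂expMeasure 1, 0 < x := by
  rw [expMeasure_one_eq]
  exact (withDensity_absolutelyContinuous _ _).ae_le (ae_restrict_mem measurableSet_Ioi)

theorem integrable_id_expMeasure_one : Integrable (fun x : ℝ => x) (expMeasure 1) := by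
  rw [integrable_expMeasure_one_iff]
  have := Real.GammaIntegral_convergent (s := 2) (by norm_num)
  norm_num at this
  exact this

theorem integral_id_expMeasure_one : ∫ x, x ∂expMeasure 1 = 1 := by
  rw [integral_expMeasure_one]
  have := Real.Gamma_eq_integral (s := 2) (by norm_num)
  norm_num at this
  exact this.symm

/-- The mean of `log h` for a standard exponential `h` is `Γ'(1) = -γ`: differentiate Euler's
integral for `Γ` under the integral sign. -/
theorem integral_log_expMeasure_one :
    ∫ x, Real.log x ∂expMeasure 1 = -Real.eulerMascheroniConstant := by
  have h1 := Complex.hasDerivAt_GammaIntegral (s := 1) (by simp)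
  have h2 : Complex.GammaIntegral =ᶠ[𝓝 1] Complex.Gamma := by
    filter_upwards [(isOpen_lt continuous_const Complex.continuous_re).mem_nhds
      (show (0 : ℝ) < (1 : ℂ).re by simp)] with s hs
    exact (Complex.Gamma_eq_integral hs).symm
  have h3 := h1.unique (Complex.hasDerivAt_Gamma_one.congr_of_eventuallyEq h2)
  have h4 : ∫ t : ℝ in Set.Ioi 0, (t : ℂ) ^ ((1 : ℂ) - 1) * (Real.log t * Real.exp (-t)) =
      ((∫ t : ℝ in Set.Ioi 0, Real.exp (-t) * Real.log t : ℝ) : ℂ) := by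
    rw [← integral_complex_ofReal]
    refine integral_congr_ae (Eventually.of_forall fun t => ?_)
    simp [mul_comm]
  rw [integral_expMeasure_one]
  rw [h4] at h3
  exact_mod_cast h3

theorem integrable_log_expMeasure_one : Integrable Real.log (expMeasure 1) := by
  -- A non-integrable function would have integral `0`, and `γ > 0`.
  refine Integrable.of_integral_ne_zero ?_
  rw [integral_log_expMeasure_one]
  have := Real.one_half_lt_eulerMascheroniConstant
  linarith

/-- `γ < H₁₂₈ - log 128 = H₁₂₈ - 7 log 2`, precise enough for the two decimals of the constant
in the throughput bound. -/
theorem eulerMascheroniConstant_le : Real.eulerMascheroniConstant ≤ 0.84 * Real.log 2 := by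
  have h1 := Real.eulerMascheroniConstant_lt_eulerMascheroniSeq' 128
  have h2 : Real.log 128 = 7 * Real.log 2 := by
    rw [show (128 : ℝ) = 2 ^ 7 by norm_num, Real.log_pow]; norm_num
  have h3 : (harmonic 128 : ℚ) ≤ 5.4342 := by
    simp only [harmonic, Finset.sum_range_succ, Finset.sum_range_zero]
    norm_num
  have h3' : ((harmonic 128 : ℚ) : ℝ) ≤ ((5.4342 : ℚ) : ℝ) := Rat.cast_le.2 h3
  simp only [Real.eulerMascheroniSeq', show (128 : ℕ) ≠ 0 by norm_num, if_false,
    Nat.cast_ofNat] at h1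
  rw [h2] at h1
  have h4 := Real.log_two_gt_d9
  push_cast at h3'
  linarith

/-! ### Mean rate over the fading channel -/

theorem rate_nonneg {g P : ℝ} (hg : 0 ≤ g) (hP : 0 ≤ P) : 0 ≤ rate g P := by
  have : 0 ≤ g * P := by positivity
  exact mul_nonneg (by norm_num) (Real.logb_nonneg (by norm_num) (by linarith))

theorem rate_le {g P : ℝ} (hg : 0 ≤ g) (hP : 0 ≤ P) : rate g P ≤ g * P := by
  have h0 : 0 ≤ g * P := by positivity
  have h1 : Real.log (1 + g * P) ≤ g * P := by
    have := Real.log_le_sub_one_of_pos (show 0 < 1 + g * P by linarith)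
    linarith
  have h2 := Real.log_two_gt_d9
  have h3 : 0 < Real.log 2 := by linarith
  rw [rate, Real.logb, mul_div_assoc', div_le_iff₀ h3]
  nlinarith

theorem rate_zero (g : ℝ) : rate g 0 = 0 := by simp [rate]

theorem measurable_rate (P : ℝ) : Measurable fun g => rate g P := by
  unfold rate Real.logb
  fun_prop

theorem integrable_rate {P : ℝ} (hP : 0 ≤ P) :
    Integrable (fun g => rate g P) (expMeasure 1) := by
  refine (integrable_id_expMeasure_one.mul_const P).mono'
    (measurable_rate P).aestronglyMeasurable ?_
  filter_upwards [ae_pos_expMeasure_one] with g hg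
  rw [Real.norm_of_nonneg (rate_nonneg hg.le hP)]
  exact rate_le hg.le hP

/-- Expected rate, over a standard exponential channel gain, for transmit energy `P`. -/
noncomputable def meanRate (P : ℝ) : ℝ := ∫ g, rate g P ∂expMeasure 1

theorem meanRate_nonneg {P : ℝ} (hP : 0 ≤ P) : 0 ≤ meanRate P := by
  refine integral_nonneg_of_ae ?_
  filter_upwards [ae_pos_expMeasure_one] with g hg using rate_nonneg hg.le hP

theorem meanRate_le {P : ℝ} (hP : 0 ≤ P) : meanRate P ≤ P := by
  calc meanRate P ≤ ∫ g, g * P ∂expMeasure 1 := by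
        refine integral_mono_ae (integrable_rate hP) (integrable_id_expMeasure_one.mul_const P) ?_
        filter_upwards [ae_pos_expMeasure_one] with g hg using rate_le hg.le hP
    _ = P := by rw [integral_mul_const, integral_id_expMeasure_one, one_mul]

/-- Fading costs at most `γ / (2 log 2)` bits compared with a channel of constant unit gain. With
`l = P / (1 + P)`, concavity of the logarithm gives
`log (1 + g P) - log (1 + P) = log ((1 - l) * 1 + l * g) ≥ l * log g`. -/
theorem le_meanRate {P : ℝ} (hP : 0 ≤ P) :
    1 / 2 * Real.logb 2 (1 + P) - 0.42 ≤ meanRate P := by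
  have hl2 : 0 < Real.log 2 := Real.log_pos (by norm_num)
  have hP1 : 0 < 1 + P := by linarith
  have hpt : ∀ g : ℝ, 0 < g →
      Real.log (1 + P) / (2 * Real.log 2)
        + P / (1 + P) / (2 * Real.log 2) * Real.log g ≤ rate g P := by
    intro g hg
    have hc : 1 / (1 + P) * Real.log 1 + P / (1 + P) * Real.log g
        ≤ Real.log (1 / (1 + P) * 1 + P / (1 + P) * g) :=
      strictConcaveOn_log_Ioi.concaveOn.2 (Set.mem_Ioi.2 one_pos) (Set.mem_Ioi.2 hg)
        (by positivity) (by positivity) (by field_simp)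
    rw [show 1 / (1 + P) * 1 + P / (1 + P) * g = (1 + g * P) / (1 + P) by field_simp,
      Real.log_div (by positivity) hP1.ne', Real.log_one] at hc
    calc Real.log (1 + P) / (2 * Real.log 2) + P / (1 + P) / (2 * Real.log 2) * Real.log g
        = (Real.log (1 + P) + P / (1 + P) * Real.log g) / (2 * Real.log 2) := by ring
      _ ≤ Real.log (1 + g * P) / (2 * Real.log 2) := by gcongr; linarith
      _ = rate g P := by rw [rate, Real.logb]; field_simp
  have hi : Integrable (fun g => Real.log (1 + P) / (2 * Real.log 2)
        + P / (1 + P) / (2 * Real.log 2) * Real.log g) (expMeasure 1) := by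
    have := isProbabilityMeasure_expMeasure (r := 1) one_pos
    exact (integrable_const _).add (integrable_log_expMeasure_one.const_mul _)
  have := isProbabilityMeasure_expMeasure (r := 1) one_pos
  have h1 : Real.log (1 + P) / (2 * Real.log 2)
      + P / (1 + P) / (2 * Real.log 2) * -Real.eulerMascheroniConstant ≤ meanRate P := by
    refine le_trans (le_of_eq ?_) (integral_mono_ae hi (integrable_rate hP) ?_)
    · rw [integral_add (integrable_const _) (integrable_log_expMeasure_one.const_mul _),
        integral_const_mul, integral_log_expMeasure_one]
      simp
    · filter_upwards [ae_pos_expMeasure_one] with g hg using hpt g hg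
  have h2 : P / (1 + P) / (2 * Real.log 2) * Real.eulerMascheroniConstant ≤ 0.42 := by
    have hl : P / (1 + P) ≤ 1 := (div_le_one hP1).2 (by linarith)
    have hγ := eulerMascheroniConstant_le
    have hγ0 : 0 ≤ Real.eulerMascheroniConstant := by
      have := Real.one_half_lt_eulerMascheroniConstant
      linarith
    calc P / (1 + P) / (2 * Real.log 2) * Real.eulerMascheroniConstant
        ≤ 1 / (2 * Real.log 2) * (0.84 * Real.log 2) := by gcongr
      _ = 0.42 := by field_simp; norm_num
  have h3 : 1 / 2 * Real.logb 2 (1 + P) = Real.log (1 + P) / (2 * Real.log 2) := by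
    rw [Real.logb]; field_simp
  rw [h3]
  linarith

/-! ### Recursion and feasibility of the policy -/

theorem packet_eq_iff {δ : ℝ} (hδ : 0 < δ) (x : ℝ) : packet δ x = δ ↔ δ < x := by
  unfold packet
  split_ifs with hx
  · simp [hx]
  · simp [hx, hδ.ne]

theorem medianCFP_zero {δ : ℝ} (hδ : 0 < δ) (x : ℕ → ℝ) :
    medianCFP δ x 0 = if δ < x 0 then 1 / 2 * δ else 0 := by
  simp [medianCFP, cfpPower, packet_eq_iff hδ]

theorem medianCFP_succ {δ : ℝ} (hδ : 0 < δ) (x : ℕ → ℝ) (t : ℕ) :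
    medianCFP δ x (t + 1) =
      if δ < x (t + 1) then 1 / 2 * δ else 1 / 2 * medianCFP δ x t := by
  classical
  simp only [medianCFP, cfpPower, packet_eq_iff hδ]
  by_cases hx : δ < x (t + 1)
  · rw [if_pos ⟨t + 1, le_rfl, hx⟩, Nat.findGreatest_eq hx]
    simp [hx]
  · rw [Nat.findGreatest_of_not hx, if_neg hx]
    by_cases he : ∃ t' ≤ t, δ < x t'
    · have he' : ∃ t' ≤ t + 1, δ < x t' := by
        obtain ⟨t', h1, h2⟩ := he
        exact ⟨t', by omega, h2⟩
      rw [if_pos he, if_pos he', Nat.succ_sub (Nat.findGreatest_le t), pow_succ]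
      ring
    · have he' : ¬ ∃ t' ≤ t + 1, δ < x t' := by
        rintro ⟨t', h1, h2⟩
        rcases Nat.le_succ_iff.1 h1 with h3 | rfl
        · exact he ⟨t', h3, h2⟩
        · exact hx h2
      rw [if_neg he, if_neg he', mul_zero]

theorem medianCFP_nonneg {δ : ℝ} (hδ : 0 < δ) (x : ℕ → ℝ) (t : ℕ) : 0 ≤ medianCFP δ x t := by
  induction t with
  | zero => rw [medianCFP_zero hδ]; split_ifs <;> linarith
  | succ t ih => rw [medianCFP_succ hδ]; split_ifs <;> linarith

theorem medianCFP_le {δ : ℝ} (hδ : 0 < δ) (x : ℕ → ℝ) (t : ℕ) :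
    2 * medianCFP δ x t ≤ δ := by
  induction t with
  | zero => rw [medianCFP_zero hδ]; split_ifs <;> linarith
  | succ t ih => rw [medianCFP_succ hδ]; split_ifs <;> linarith

/-- The battery always holds at least twice the energy about to be used: what is left of the last
packet is twice that energy, and neither earlier packets nor the capacity reduce it. Only
`packet δ x ≤ E` is needed of the stored energies `E`. -/
theorem two_mul_medianCFP_le_battery {cap b₀ δ : ℝ} (hb₀ : 0 ≤ b₀) (hδ : 0 < δ) (hcap : δ ≤ cap)
    {x E : ℕ → ℝ} (hE : ∀ t, packet δ (x t) ≤ E t) (t : ℕ) :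
    2 * medianCFP δ x t ≤ battery cap b₀ E (medianCFP δ x) t := by
  induction t with
  | zero =>
    have h0 := hE 0
    have h1 := medianCFP_le hδ x 0
    rw [battery]
    refine le_min ?_ (h1.trans hcap)
    rw [medianCFP_zero hδ]
    unfold packet at h0
    split_ifs at h0 ⊢ <;> linarith
  | succ t ih =>
    have h0 := hE (t + 1)
    have h1 := medianCFP_le hδ x (t + 1)
    have h2 := medianCFP_nonneg hδ x t
    rw [battery]
    refine le_min ?_ (h1.trans hcap)
    rw [medianCFP_succ hδ]
    unfold packet at h0
    split_ifs at h0 ⊢ <;> linarith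

theorem energyNeutral_medianCFP {cap b₀ δ : ℝ} (hb₀ : 0 ≤ b₀) (hδ : 0 < δ) (hcap : δ ≤ cap)
    {x E : ℕ → ℝ} (hE : ∀ t, packet δ (x t) ≤ E t) :
    EnergyNeutral cap b₀ E (medianCFP δ x) := fun t => by
  have h1 := two_mul_medianCFP_le_battery hb₀ hδ hcap hE t
  have h2 := medianCFP_nonneg hδ x t
  exact ⟨h2, by linarith⟩

/-! ### Decomposition by the time since the last packet -/

/-- Indicator that a packet arrives in slot `s` and none in the `j` slots after it. -/
noncomputable def gapIndicator (δ : ℝ) (x : ℕ → ℝ) (s : ℕ) : ℕ → ℝ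
  | 0 => if δ < x s then 1 else 0
  | j + 1 => gapIndicator δ x s j * if δ < x (s + j + 1) then 0 else 1

theorem gapIndicator_mem (δ : ℝ) (x : ℕ → ℝ) (s j : ℕ) :
    0 ≤ gapIndicator δ x s j ∧ gapIndicator δ x s j ≤ 1 := by
  induction j with
  | zero => rw [gapIndicator]; split_ifs <;> norm_num
  | succ j ih => rw [gapIndicator]; split_ifs <;> simp [ih]

/-- Sorting the slots by the time since the last packet turns a function of the transmit energy
into a sum over that time. -/
theorem apply_medianCFP {δ : ℝ} (hδ : 0 < δ) (x : ℕ → ℝ) (f : ℝ → ℝ) (hf : f 0 = 0) (t : ℕ) :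
    f (medianCFP δ x t) = ∑ j ∈ Finset.range (t + 1),
      gapIndicator δ x (t - j) j * f ((1 / 2) ^ (j + 1) * δ) := by
  induction t generalizing f with
  | zero =>
    rw [medianCFP_zero hδ]
    simp only [zero_add, Finset.sum_range_one, gapIndicator, pow_one]
    split_ifs <;> simp [hf]
  | succ t ih =>
    rw [medianCFP_succ hδ, Finset.sum_range_succ']
    have hgap : ∀ j ∈ Finset.range (t + 1), gapIndicator δ x (t + 1 - (j + 1)) (j + 1)
        * f ((1 / 2) ^ (j + 1 + 1) * δ) = (gapIndicator δ x (t - j) j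
        * f (1 / 2 * ((1 / 2) ^ (j + 1) * δ))) * if δ < x (t + 1) then 0 else 1 := by
      intro j hj
      have hj' : j ≤ t := Nat.lt_succ_iff.1 (Finset.mem_range.1 hj)
      rw [Nat.add_sub_add_right, gapIndicator, Nat.sub_add_cancel hj',
        show (1 / 2 : ℝ) ^ (j + 1 + 1) * δ = 1 / 2 * ((1 / 2) ^ (j + 1) * δ) by ring]
      ring
    rw [Finset.sum_congr rfl hgap, ← Finset.sum_mul,
      ← ih (fun p => f (1 / 2 * p)) (by simpa using hf)]
    simp only [gapIndicator, Nat.sub_zero, zero_add, pow_one]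
    split_ifs <;> simp

/-! ### Averages of sequences -/

/-- Average of a sequence along an initial segment of length asymptotic to `a * N`. -/
theorem tendsto_sum_range_comp_div {y : ℕ → ℝ} {L a : ℝ} {c : ℕ → ℕ}
    (hy : Tendsto (fun n : ℕ => (∑ i ∈ Finset.range n, y i) / n) atTop (𝓝 L))
    (hc : Tendsto c atTop atTop) (ha : Tendsto (fun N : ℕ => (c N : ℝ) / N) atTop (𝓝 a)) :
    Tendsto (fun N : ℕ => (∑ i ∈ Finset.range (c N), y i) / N) atTop (𝓝 (L * a)) := by
  refine ((hy.comp hc).mul ha).congr fun N => ?_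
  rcases eq_or_ne (c N) 0 with h0 | h0
  · simp [h0]
  · have : (c N : ℝ) ≠ 0 := by exact_mod_cast h0
    simp only [Function.comp_apply]
    field_simp

/-- The number of `t < N` congruent to `i < k` modulo `k` is `(N + k - 1 - i) / k`. -/
theorem sum_range_eq_sum_residues (y : ℕ → ℝ) {k : ℕ} (hk : 0 < k) (N : ℕ) :
    ∑ t ∈ Finset.range N, y t = ∑ i ∈ Finset.range k,
      ∑ m ∈ Finset.range ((N + (k - 1 - i)) / k), y (i + k * m) := by
  induction N with
  | zero =>
    symm
    refine Finset.sum_eq_zero fun i hi => ?_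
    rw [Nat.div_eq_of_lt (by omega)]
    simp
  | succ N ih =>
    have hq := Nat.div_add_mod N k
    have hr := Nat.mod_lt N hk
    have hdiv : ∀ a q : ℕ, k * q ≤ a → a < k * q + k → a / k = q := fun a q h1 h2 =>
      Nat.div_eq_of_lt_le (by rwa [mul_comm]) (by rwa [Nat.succ_mul, mul_comm q])
    have hmul : k * (N / k + 1) = k * (N / k) + k := by ring
    have hstep : ∀ i ∈ Finset.range k,
        ∑ m ∈ Finset.range ((N + 1 + (k - 1 - i)) / k), y (i + k * m) =
        ∑ m ∈ Finset.range ((N + (k - 1 - i)) / k), y (i + k * m)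
          + if N % k = i then y N else 0 := by
      intro i hi
      have hi' := Finset.mem_range.1 hi
      rcases lt_trichotomy (N % k) i with h | h | h
      · rw [if_neg h.ne, add_zero, hdiv (N + 1 + _) (N / k) (by omega) (by omega),
          hdiv (N + _) (N / k) (by omega) (by omega)]
      · rw [if_pos h, hdiv (N + 1 + _) (N / k + 1) (by omega) (by omega),
          hdiv (N + _) (N / k) (by omega) (by omega), Finset.sum_range_succ,
          show i + k * (N / k) = N by omega]
      · rw [if_neg h.ne', add_zero, hdiv (N + 1 + _) (N / k + 1) (by omega) (by omega),
          hdiv (N + _) (N / k + 1) (by omega) (by omega)]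
    rw [Finset.sum_range_succ, ih, Finset.sum_congr rfl hstep, Finset.sum_add_distrib,
      Finset.sum_ite_eq, if_pos (Finset.mem_range.2 hr)]

theorem tendsto_average_of_residues {y : ℕ → ℝ} {k : ℕ} (hk : 0 < k) {L : ℝ}
    (hy : ∀ i < k, Tendsto (fun n : ℕ => (∑ m ∈ Finset.range n, y (i + k * m)) / n)
      atTop (𝓝 L)) :
    Tendsto (fun N : ℕ => (∑ t ∈ Finset.range N, y t) / N) atTop (𝓝 L) := by
  have hk0 : (0 : ℝ) < k := by exact_mod_cast hk
  have hterm : ∀ i ∈ Finset.range k, Tendsto (fun N : ℕ =>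
      (∑ m ∈ Finset.range ((N + (k - 1 - i)) / k), y (i + k * m)) / N)
      atTop (𝓝 (L * (1 / k))) := by
    intro i hi
    refine tendsto_sum_range_comp_div (hy i (Finset.mem_range.1 hi)) ?_ ?_
    · exact (Nat.tendsto_div_const_atTop hk.ne').comp (tendsto_add_atTop_nat _)
    · rw [tendsto_iff_dist_tendsto_zero]
      refine squeeze_zero' (Eventually.of_forall fun _ => dist_nonneg) ?_
        tendsto_one_div_atTop_nhds_zero_nat
      filter_upwards [eventually_gt_atTop 0] with N hN
      have hN0 : (0 : ℝ) < N := by exact_mod_cast hN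
      have h1 := Nat.div_add_mod (N + (k - 1 - i)) k
      have h2 := Nat.mod_lt (N + (k - 1 - i)) hk
      set c := (N + (k - 1 - i)) / k
      have h3 : k * c ≤ N + k := by omega
      have h4 : N ≤ k * c + k := by omega
      have h3' : (k : ℝ) * c ≤ N + k := by exact_mod_cast h3
      have h4' : (N : ℝ) ≤ k * c + k := by exact_mod_cast h4
      rw [Real.dist_eq, show (c : ℝ) / N - 1 / k = (k * c - N) / k / N by field_simp, abs_div,
        abs_div, abs_of_pos hN0, abs_of_pos hk0]
      gcongr
      rw [div_le_one hk0, abs_le]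
      constructor <;> linarith
  have := tendsto_finsetSum (Finset.range k) hterm
  simp only [Finset.sum_const, Finset.card_range, nsmul_eq_mul] at this
  rw [show (k : ℝ) * (L * (1 / k)) = L by field_simp] at this
  refine this.congr fun N => ?_
  rw [← Finset.sum_div, ← sum_range_eq_sum_residues y hk]

theorem sum_range_sum_range_sub (V : ℕ → ℕ → ℝ) (N : ℕ) :
    ∑ t ∈ Finset.range N, ∑ j ∈ Finset.range (t + 1), V j (t - j) =
      ∑ j ∈ Finset.range N, ∑ s ∈ Finset.range (N - j), V j s := by
  induction N with
  | zero => simp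
  | succ N ih =>
    have hstep : ∀ j ∈ Finset.range (N + 1), ∑ s ∈ Finset.range (N + 1 - j), V j s =
        ∑ s ∈ Finset.range (N - j), V j s + V j (N - j) := by
      intro j hj
      rw [Nat.succ_sub (Nat.lt_succ_iff.1 (Finset.mem_range.1 hj)), Finset.sum_range_succ]
    rw [Finset.sum_range_succ, ih, Finset.sum_congr rfl hstep, Finset.sum_add_distrib,
      Finset.sum_range_succ (fun j => ∑ s ∈ Finset.range (N - j), V j s)]
    simp

/-- Tannery's theorem for the averages of a convolution-like double sum. -/
theorem tendsto_average_sum_range {V : ℕ → ℕ → ℝ} {R g b : ℕ → ℝ} {G : ℝ}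
    (hg0 : ∀ t, 0 ≤ g t) (hb0 : ∀ j, 0 ≤ b j) (hb : Summable b)
    (hg : Tendsto (fun N : ℕ => (∑ t ∈ Finset.range N, g t) / N) atTop (𝓝 G))
    (hV : ∀ j s, |V j s| ≤ g (s + j) * b j)
    (hR : ∀ j, Tendsto (fun N : ℕ => (∑ s ∈ Finset.range N, V j s) / N) atTop (𝓝 (R j))) :
    Tendsto (fun N : ℕ =>
      (∑ t ∈ Finset.range N, ∑ j ∈ Finset.range (t + 1), V j (t - j)) / N)
      atTop (𝓝 (∑' j, R j)) := by
  obtain ⟨C, hC⟩ := hg.bddAbove_range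
  have hC' : ∀ N : ℕ, (∑ t ∈ Finset.range N, g t) / N ≤ C := fun N => hC ⟨N, rfl⟩
  have hlim : Tendsto (fun N : ℕ => ∑' j, (∑ s ∈ Finset.range (N - j), V j s) / N)
      atTop (𝓝 (∑' j, R j)) := by
    refine tendsto_tsum_of_dominated_convergence (bound := fun j => C * b j)
      (hb.mul_left C) (fun j => ?_) (Eventually.of_forall fun N j => ?_)
    · rw [← mul_one (R j)]
      refine tendsto_sum_range_comp_div (hR j) (tendsto_sub_atTop_nat j) ?_
      have h1 : Tendsto (fun N : ℕ => 1 - (j : ℝ) / N) atTop (𝓝 (1 - 0)) :=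
        tendsto_const_nhds.sub (tendsto_const_div_atTop_nhds_zero_nat _)
      rw [sub_zero] at h1
      refine h1.congr' ?_
      filter_upwards [eventually_gt_atTop 0, eventually_ge_atTop j] with N hN hj
      have hN0 : (N : ℝ) ≠ 0 := by exact_mod_cast hN.ne'
      rw [Nat.cast_sub hj]
      field_simp
    · rw [Real.norm_eq_abs, abs_div, Nat.abs_cast]
      have h1 : |∑ s ∈ Finset.range (N - j), V j s| ≤ (∑ t ∈ Finset.range N, g t) * b j := by
        calc |∑ s ∈ Finset.range (N - j), V j s|
            ≤ ∑ s ∈ Finset.range (N - j), g (s + j) * b j :=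
              (Finset.abs_sum_le_sum_abs _ _).trans (Finset.sum_le_sum fun s _ => hV j s)
          _ = (∑ s ∈ Finset.range (N - j), g (s + j)) * b j := by rw [Finset.sum_mul]
          _ ≤ (∑ t ∈ Finset.range N, g t) * b j := by
              refine mul_le_mul_of_nonneg_right ?_ (hb0 j)
              rcases le_total N j with h | h
              · rw [Nat.sub_eq_zero_of_le h, Finset.sum_range_zero]
                exact Finset.sum_nonneg fun t _ => hg0 t
              · conv_rhs => rw [← Nat.sub_add_cancel h, add_comm, Finset.sum_range_add]
                simp only [add_comm]
                exact le_add_of_nonneg_left (Finset.sum_nonneg fun t _ => hg0 t)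
      calc |∑ s ∈ Finset.range (N - j), V j s| / N
          ≤ (∑ t ∈ Finset.range N, g t) * b j / N := by gcongr
        _ = (∑ t ∈ Finset.range N, g t) / N * b j := by ring
        _ ≤ C * b j := mul_le_mul_of_nonneg_right (hC' N) (hb0 j)
  refine hlim.congr fun N => ?_
  rw [sum_range_sum_range_sub, Finset.sum_div]
  refine tsum_eq_sum fun j hj => ?_
  rw [Nat.sub_eq_zero_of_le (by simpa using hj)]
  simp

/-! ### Independence of functions of disjoint subfamilies -/

theorem iIndepFun_sumElim {Ω ι κ : Type*} [MeasurableSpace Ω] {μ : Measure Ω}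
    {X : ι → Ω → ℝ} {Y : κ → Ω → ℝ} (hX : iIndepFun X μ) (hY : iIndepFun Y μ)
    (hXY : IndepFun (fun ω i => X i ω) (fun ω k => Y k ω) μ) :
    iIndepFun (Sum.elim X Y) μ := by
  rw [iIndepFun_iff_measure_inter_preimage_eq_mul]
  intro S sets hsets
  have hA : MeasurableSet {x : ι → ℝ | ∀ i ∈ S.toLeft, x i ∈ sets (Sum.inl i)} := by
    have : {x : ι → ℝ | ∀ i ∈ S.toLeft, x i ∈ sets (Sum.inl i)} =
        ⋂ i ∈ S.toLeft, (fun x : ι → ℝ => x i) ⁻¹' sets (Sum.inl i) := by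
      ext x; simp
    rw [this]
    exact Finset.measurableSet_biInter _ fun i hi =>
      measurable_pi_apply i (hsets _ (Finset.mem_toLeft.1 hi))
  have hB : MeasurableSet {y : κ → ℝ | ∀ k ∈ S.toRight, y k ∈ sets (Sum.inr k)} := by
    have : {y : κ → ℝ | ∀ k ∈ S.toRight, y k ∈ sets (Sum.inr k)} =
        ⋂ k ∈ S.toRight, (fun y : κ → ℝ => y k) ⁻¹' sets (Sum.inr k) := by
      ext y; simp
    rw [this]
    exact Finset.measurableSet_biInter _ fun k hk =>
      measurable_pi_apply k (hsets _ (Finset.mem_toRight.1 hk))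
  have hX' := hX.measure_inter_preimage_eq_mul S.toLeft (sets := fun i => sets (Sum.inl i))
    fun i hi => hsets _ (Finset.mem_toLeft.1 hi)
  have hY' := hY.measure_inter_preimage_eq_mul S.toRight (sets := fun k => sets (Sum.inr k))
    fun k hk => hsets _ (Finset.mem_toRight.1 hk)
  have h1 := hXY.measure_inter_preimage_eq_mul _ _ hA hB
  have h2 : (fun ω i => X i ω) ⁻¹' {x : ι → ℝ | ∀ i ∈ S.toLeft, x i ∈ sets (Sum.inl i)} =
      ⋂ i ∈ S.toLeft, X i ⁻¹' sets (Sum.inl i) := by ext ω; simp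
  have h3 : (fun ω k => Y k ω) ⁻¹' {y : κ → ℝ | ∀ k ∈ S.toRight, y k ∈ sets (Sum.inr k)} =
      ⋂ k ∈ S.toRight, Y k ⁻¹' sets (Sum.inr k) := by ext ω; simp
  rw [h2, h3, hX', hY'] at h1
  rw [Finset.prod_sum_eq_prod_toLeft_mul_prod_toRight]
  refine Eq.trans (congrArg μ ?_) h1
  ext ω
  simp [Sum.forall]

/-- Functions of disjoint subfamilies of an independent family are independent. -/
theorem indepFun_of_measurable_iSup {Ω ι : Type*} [MeasurableSpace Ω] {μ : Measure Ω}
    {W : ι → Ω → ℝ} (hWm : ∀ i, Measurable (W i)) (hW : iIndepFun W μ) {S T : Set ι}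
    (hST : Disjoint S T) {f g : Ω → ℝ}
    (hf : Measurable[⨆ i ∈ S, MeasurableSpace.comap (W i) inferInstance] f)
    (hg : Measurable[⨆ i ∈ T, MeasurableSpace.comap (W i) inferInstance] g) :
    IndepFun f g μ := by
  rw [IndepFun_iff_Indep]
  have h := indep_iSup_of_disjoint (fun i => (hWm i).comap_le) hW.iIndep hST
  exact indep_of_indep_of_le_left (indep_of_indep_of_le_right h hg.comap_le) hf.comap_le

theorem measurable_iSup_comap {Ω ι : Type*} (W : ι → Ω → ℝ) {S : Set ι} {i : ι} (hi : i ∈ S) :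
    Measurable[⨆ i ∈ S, MeasurableSpace.comap (W i) inferInstance] (W i) :=
  (comap_measurable (W i)).mono
    (le_iSup₂_of_le (f := fun i (_ : i ∈ S) => MeasurableSpace.comap (W i) inferInstance)
      i hi le_rfl) le_rfl

/-! ### Law of the gap rates -/

theorem measurable_gapIndicator {Ω : Type*} {mΩ : MeasurableSpace Ω} {X : ℕ → Ω → ℝ} (δ : ℝ)
    {s j : ℕ} (hX : ∀ i, s ≤ i → i ≤ s + j → Measurable (X i)) :
    Measurable fun ω => gapIndicator δ (fun i => X i ω) s j := by
  induction j with
  | zero =>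
    exact Measurable.ite (measurableSet_lt measurable_const (hX s le_rfl le_rfl))
      measurable_const measurable_const
  | succ j ih =>
    refine (ih fun i h1 h2 => hX i h1 (by omega)).mul ?_
    exact Measurable.ite (measurableSet_lt measurable_const (hX _ (by omega) (by omega)))
      measurable_const measurable_const

/-- Rate achieved in slot `s + j` if a packet arrives in slot `s` and none in the `j` slots after
it; zero otherwise. -/
noncomputable def gapRate {Ω : Type*} (δ : ℝ) (X h : ℕ → Ω → ℝ) (j s : ℕ) (ω : Ω) : ℝ :=
  gapIndicator δ (fun i => X i ω) s j * rate (h (s + j) ω) ((1 / 2) ^ (j + 1) * δ)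

theorem rate_medianCFP_eq {Ω : Type*} {δ : ℝ} (hδ : 0 < δ) (X h : ℕ → Ω → ℝ) (t : ℕ) (ω : Ω) :
    rate (h t ω) (medianCFP δ (fun s => X s ω) t) =
      ∑ j ∈ Finset.range (t + 1), gapRate δ X h j (t - j) ω := by
  rw [apply_medianCFP hδ _ (rate (h t ω)) (rate_zero _)]
  refine Finset.sum_congr rfl fun j hj => ?_
  rw [gapRate, Nat.sub_add_cancel (Nat.lt_succ_iff.1 (Finset.mem_range.1 hj))]

theorem measureReal_preimage_Iic {Ω : Type*} [MeasurableSpace Ω] {μ : Measure Ω}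
    [IsProbabilityMeasure μ] {Y : Ω → ℝ} (hY : Measurable Y) (δ : ℝ) :
    μ.real (Y ⁻¹' Set.Iic δ) = cdf (μ.map Y) δ := by
  have := Measure.isProbabilityMeasure_map (μ := μ) hY.aemeasurable
  rw [cdf_eq_real, map_measureReal_apply hY measurableSet_Iic]

section Law

variable {Ω : Type*} [MeasurableSpace Ω] {μ : Measure Ω} {X h : ℕ → Ω → ℝ} {δ : ℝ}

theorem indepFun_gapIndicator_arrival (hXm : ∀ t, Measurable (X t)) (hX : iIndepFun X μ)
    (s j : ℕ) :
    IndepFun (fun ω => gapIndicator δ (fun i => X i ω) s j) (X (s + j + 1)) μ := by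
  refine indepFun_of_measurable_iSup hXm hX (S := Set.Icc s (s + j)) (T := {s + j + 1})
    (by simp) ?_ (measurable_iSup_comap X rfl)
  exact measurable_gapIndicator (mΩ := ⨆ i ∈ Set.Icc s (s + j), _) δ
    fun i h1 h2 => measurable_iSup_comap X (Set.mem_Icc.2 ⟨h1, h2⟩)

theorem indepFun_gapIndicator_gain
    (hXh : IndepFun (fun ω t => X t ω) (fun ω t => h t ω) μ) (s j t : ℕ) :
    IndepFun (fun ω => gapIndicator δ (fun i => X i ω) s j) (h t) μ :=
  hXh.comp (φ := fun x : ℕ → ℝ => gapIndicator δ x s j) (ψ := fun y : ℕ → ℝ => y t)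
    (measurable_gapIndicator δ (X := fun i (x : ℕ → ℝ) => x i) fun i _ _ => measurable_pi_apply i)
    (measurable_pi_apply t)

theorem identDistrib_gapIndicator [IsProbabilityMeasure μ]
    (hXm : ∀ t, Measurable (X t)) (hX : iIndepFun X μ)
    (hid : ∀ t, IdentDistrib (X t) (X 0) μ μ) (s j : ℕ) :
    IdentDistrib (fun ω => gapIndicator δ (fun i => X i ω) s j)
      (fun ω => gapIndicator δ (fun i => X i ω) 0 j) μ μ := by
  induction j with
  | zero =>
    exact (hid s).comp (u := fun x => if δ < x then (1 : ℝ) else 0)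
      (Measurable.ite measurableSet_Ioi measurable_const measurable_const)
  | succ j ih =>
    have := IdentDistrib.prodMk ih ((hid (s + j + 1)).trans (hid (0 + j + 1)).symm)
      (indepFun_gapIndicator_arrival hXm hX s j) (indepFun_gapIndicator_arrival hXm hX 0 j)
    exact this.comp (u := fun p : ℝ × ℝ => p.1 * if δ < p.2 then 0 else 1)
      (measurable_fst.mul (Measurable.ite (measurableSet_lt measurable_const measurable_snd)
        measurable_const measurable_const))

theorem integral_gapIndicator [IsProbabilityMeasure μ]
    (hXm : ∀ t, Measurable (X t)) (hX : iIndepFun X μ)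
    (hid : ∀ t, IdentDistrib (X t) (X 0) μ μ) (hmed : cdf (μ.map (X 0)) δ = 1 / 2) (s j : ℕ) :
    ∫ ω, gapIndicator δ (fun i => X i ω) s j ∂μ = (1 / 2) ^ (j + 1) := by
  have hle := (measureReal_preimage_Iic (hXm 0) δ).trans hmed
  have hno : ∀ t, ∫ ω, (if δ < X t ω then (0 : ℝ) else 1) ∂μ = 1 / 2 := fun t => by
    have h1 := ((hid t).comp (u := fun x => if δ < x then (0 : ℝ) else 1)
      (Measurable.ite measurableSet_Ioi measurable_const measurable_const)).integral_eq
    simp only [Function.comp_apply] at h1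
    rw [h1, ← hle, ← integral_indicator_one ((hXm 0) measurableSet_Iic)]
    refine integral_congr_ae (Eventually.of_forall fun ω => ?_)
    by_cases hω : δ < X 0 ω
    · simp [hω]
    · simp [hω, not_lt.1 hω]
  induction j with
  | zero =>
    have h1 : ∀ ω, gapIndicator δ (fun i => X i ω) s 0 = 1 - if δ < X s ω then (0 : ℝ) else 1 := by
      intro ω
      rw [gapIndicator]
      split_ifs <;> simp
    simp only [h1]
    rw [integral_sub (integrable_const _), hno s]
    · simp; norm_num
    · refine Integrable.of_integral_ne_zero ?_
      rw [hno s]; norm_num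
  | succ j ih =>
    have hm : Measurable fun x : ℝ => if δ < x then (0 : ℝ) else 1 :=
      Measurable.ite measurableSet_Ioi measurable_const measurable_const
    have hind := (indepFun_gapIndicator_arrival (δ := δ) hXm hX s j).comp measurable_id hm
    have := hind.integral_fun_mul_eq_mul_integral
      (measurable_gapIndicator δ fun i _ _ => hXm i).aestronglyMeasurable
      (hm.comp (hXm _)).aestronglyMeasurable
    simp only [Function.comp_apply, id_eq] at this
    rw [ih, hno] at this
    simp only [gapIndicator]
    rw [this, pow_succ _ (j + 1)]

theorem integral_comp_gain (hhm : ∀ t, Measurable (h t)) (hh : ∀ t, μ.map (h t) = expMeasure 1)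
    (P : ℝ) (t : ℕ) : ∫ ω, rate (h t ω) P ∂μ = meanRate P := by
  rw [meanRate, ← hh t,
    integral_map (hhm t).aemeasurable (measurable_rate P).aestronglyMeasurable]

theorem integrable_comp_gain (hhm : ∀ t, Measurable (h t))
    (hh : ∀ t, μ.map (h t) = expMeasure 1) {f : ℝ → ℝ} (hf : Integrable f (expMeasure 1))
    (t : ℕ) : Integrable (fun ω => f (h t ω)) μ := by
  rw [← hh t] at hf
  exact hf.comp_measurable (hhm t)

theorem ae_gain_pos (hhm : ∀ t, Measurable (h t)) (hh : ∀ t, μ.map (h t) = expMeasure 1) :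
    ∀ᵐ ω ∂μ, ∀ t, 0 < h t ω := by
  refine ae_all_iff.2 fun t => ?_
  have := ae_pos_expMeasure_one
  rw [← hh t] at this
  exact ae_of_ae_map (hhm t).aemeasurable this

theorem identDistrib_gain (hhm : ∀ t, Measurable (h t)) (hh : ∀ t, μ.map (h t) = expMeasure 1)
    (s t : ℕ) : IdentDistrib (h s) (h t) μ μ :=
  ⟨(hhm s).aemeasurable, (hhm t).aemeasurable, by rw [hh s, hh t]⟩

theorem indepFun_gapIndicator_rate
    (hXh : IndepFun (fun ω t => X t ω) (fun ω t => h t ω) μ) (s j t : ℕ) (P : ℝ) :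
    IndepFun (fun ω => gapIndicator δ (fun i => X i ω) s j) (fun ω => rate (h t ω) P) μ :=
  (indepFun_gapIndicator_gain hXh s j t).comp measurable_id (measurable_rate P)

theorem integrable_gapRate [IsProbabilityMeasure μ] (hδ : 0 < δ) (hXm : ∀ t, Measurable (X t))
    (hhm : ∀ t, Measurable (h t)) (hh : ∀ t, μ.map (h t) = expMeasure 1) (j s : ℕ) :
    Integrable (gapRate δ X h j s) μ := by
  refine (integrable_comp_gain hhm hh (integrable_rate (P := (1 / 2) ^ (j + 1) * δ)
    (by positivity)) (s + j)).bdd_mul (c := 1)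
    (measurable_gapIndicator δ fun i _ _ => hXm i).aestronglyMeasurable
    (Eventually.of_forall fun ω => ?_)
  have := gapIndicator_mem δ (fun i => X i ω) s j
  rw [Real.norm_of_nonneg this.1]
  exact this.2

theorem integral_gapRate [IsProbabilityMeasure μ] (hXm : ∀ t, Measurable (X t))
    (hX : iIndepFun X μ) (hid : ∀ t, IdentDistrib (X t) (X 0) μ μ)
    (hmed : cdf (μ.map (X 0)) δ = 1 / 2)
    (hhm : ∀ t, Measurable (h t)) (hh : ∀ t, μ.map (h t) = expMeasure 1)
    (hXh : IndepFun (fun ω t => X t ω) (fun ω t => h t ω) μ) (j s : ℕ) :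
    ∫ ω, gapRate δ X h j s ω ∂μ = (1 / 2) ^ (j + 1) * meanRate ((1 / 2) ^ (j + 1) * δ) := by
  have := (indepFun_gapIndicator_rate (δ := δ) hXh s j (s + j)
    ((1 / 2) ^ (j + 1) * δ)).integral_fun_mul_eq_mul_integral
    (measurable_gapIndicator δ fun i _ _ => hXm i).aestronglyMeasurable
    ((measurable_rate _).comp (hhm _)).aestronglyMeasurable
  rw [integral_gapIndicator hXm hX hid hmed, integral_comp_gain hhm hh] at this
  exact this

theorem identDistrib_gapRate [IsProbabilityMeasure μ] (hXm : ∀ t, Measurable (X t))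
    (hX : iIndepFun X μ) (hid : ∀ t, IdentDistrib (X t) (X 0) μ μ)
    (hhm : ∀ t, Measurable (h t)) (hh : ∀ t, μ.map (h t) = expMeasure 1)
    (hXh : IndepFun (fun ω t => X t ω) (fun ω t => h t ω) μ) (j s t : ℕ) :
    IdentDistrib (gapRate δ X h j s) (gapRate δ X h j t) μ μ := by
  have := IdentDistrib.prodMk
    ((identDistrib_gapIndicator (δ := δ) hXm hX hid s j).trans
      (identDistrib_gapIndicator hXm hX hid t j).symm)
    (identDistrib_gain hhm hh (s + j) (t + j))
    (indepFun_gapIndicator_gain hXh s j (s + j)) (indepFun_gapIndicator_gain hXh t j (t + j))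
  exact this.comp (u := fun p : ℝ × ℝ => p.1 * rate p.2 ((1 / 2) ^ (j + 1) * δ))
    (measurable_fst.mul ((measurable_rate _).comp measurable_snd))

/-- Gap rates over disjoint windows of slots are independent. -/
theorem indepFun_gapRate (hXm : ∀ t, Measurable (X t)) (hX : iIndepFun X μ)
    (hhm : ∀ t, Measurable (h t)) (hh : iIndepFun h μ)
    (hXh : IndepFun (fun ω t => X t ω) (fun ω t => h t ω) μ) {j s t : ℕ} (hst : s + j < t) :
    IndepFun (gapRate δ X h j s) (gapRate δ X h j t) μ := by
  -- `S s` indexes the arrivals and gains of the slots `s, …, s + j`.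
  let S : ℕ → Set (ℕ ⊕ ℕ) := fun s => {c | Sum.elim id id c ∈ Set.Icc s (s + j)}
  have hmeas : ∀ s, Measurable[⨆ c ∈ S s, MeasurableSpace.comap (Sum.elim X h c) inferInstance]
      (gapRate δ X h j s) := fun s => by
    refine Measurable.mul (m := ⨆ c ∈ S s, _) (measurable_gapIndicator (mΩ := ⨆ c ∈ S s, _) δ
      fun i h1 h2 => ?_) ((measurable_rate _).comp ?_)
    · exact measurable_iSup_comap (Sum.elim X h) (S := S s) (i := Sum.inl i) ⟨h1, h2⟩
    · exact measurable_iSup_comap (Sum.elim X h) (S := S s) (i := Sum.inr (s + j))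
        ⟨Nat.le_add_right s j, le_rfl⟩
  refine indepFun_of_measurable_iSup (by rintro (i | i); exacts [hXm i, hhm i])
    (iIndepFun_sumElim hX hh hXh) ?_ (hmeas s) (hmeas t)
  refine Set.disjoint_left.2 fun c h1 h2 => ?_
  have h3 : Sum.elim id id c ≤ s + j := h1.2
  have h4 : t ≤ Sum.elim id id c := h2.1
  omega

/-- Strong law for the gap rates with `j` fixed. Slots in the same class modulo `j + 1` have
disjoint windows, so the strong law for pairwise independent variables applies to each class. -/
theorem ae_tendsto_average_gapRate [IsProbabilityMeasure μ] (hδ : 0 < δ)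
    (hXm : ∀ t, Measurable (X t))
    (hX : iIndepFun X μ) (hid : ∀ t, IdentDistrib (X t) (X 0) μ μ)
    (hmed : cdf (μ.map (X 0)) δ = 1 / 2) (hhm : ∀ t, Measurable (h t)) (hhi : iIndepFun h μ)
    (hh : ∀ t, μ.map (h t) = expMeasure 1)
    (hXh : IndepFun (fun ω t => X t ω) (fun ω t => h t ω) μ) (j : ℕ) :
    ∀ᵐ ω ∂μ, Tendsto (fun N : ℕ => (∑ s ∈ Finset.range N, gapRate δ X h j s ω) / N) atTop
      (𝓝 ((1 / 2) ^ (j + 1) * meanRate ((1 / 2) ^ (j + 1) * δ))) := by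
  have hres : ∀ i, ∀ᵐ ω ∂μ, Tendsto (fun n : ℕ =>
      (∑ m ∈ Finset.range n, gapRate δ X h j (i + (j + 1) * m) ω) / n) atTop
      (𝓝 ((1 / 2) ^ (j + 1) * meanRate ((1 / 2) ^ (j + 1) * δ))) := fun i => by
    rw [← integral_gapRate hXm hX hid hmed hhm hh hXh j (i + (j + 1) * 0)]
    refine strong_law_ae_real (fun m => gapRate δ X h j (i + (j + 1) * m))
      (integrable_gapRate hδ hXm hhm hh _ _) (fun m n hmn => ?_)
      fun m => identDistrib_gapRate hXm hX hid hhm hh hXh _ _ _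
    have hlt : ∀ {m n : ℕ}, m < n → i + (j + 1) * m + j < i + (j + 1) * n := fun {m n} hmn => by
      have : (j + 1) * (m + 1) ≤ (j + 1) * n := Nat.mul_le_mul_left _ hmn
      rw [mul_add] at this
      omega
    rcases lt_or_gt_of_ne hmn with hmn | hmn
    · exact indepFun_gapRate hXm hX hhm hhi hXh (hlt hmn)
    · exact (indepFun_gapRate hXm hX hhm hhi hXh (hlt hmn)).symm
  filter_upwards [ae_all_iff.2 hres] with ω hω
  exact tendsto_average_of_residues j.succ_pos fun i _ => hω i

theorem ae_tendsto_average_gain (hhm : ∀ t, Measurable (h t)) (hhi : iIndepFun h μ)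
    (hh : ∀ t, μ.map (h t) = expMeasure 1) :
    ∀ᵐ ω ∂μ, Tendsto (fun N : ℕ => (∑ t ∈ Finset.range N, h t ω) / N) atTop (𝓝 1) := by
  have h1 : ∫ ω, h 0 ω ∂μ = 1 := by
    rw [← integral_id_expMeasure_one, ← hh 0,
      integral_map (hhm 0).aemeasurable (f := fun x => x) measurable_id.aestronglyMeasurable]
  rw [← h1]
  exact strong_law_ae_real h (integrable_comp_gain hhm hh integrable_id_expMeasure_one 0)
    (fun s t hst => hhi.indepFun hst) fun t => identDistrib_gain hhm hh t 0

end Law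

/-! ### Existence of the throughput -/

theorem summable_gap_meanRate {δ : ℝ} (hδ : 0 < δ) :
    Summable fun j : ℕ => (1 / 2 : ℝ) ^ (j + 1) * meanRate ((1 / 2) ^ (j + 1) * δ) := by
  have hgeo : Summable fun j : ℕ => (1 / 2 : ℝ) ^ (j + 1) * δ :=
    ((summable_nat_add_iff 1).2 summable_geometric_two).mul_right δ
  refine Summable.of_nonneg_of_le (fun j => ?_) (fun j => ?_) hgeo
  · exact mul_nonneg (by positivity) (meanRate_nonneg (by positivity))
  · have h1 := meanRate_le (P := (1 / 2) ^ (j + 1) * δ) (by positivity)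
    have h2 : (1 / 2 : ℝ) ^ (j + 1) ≤ 1 := pow_le_one₀ (by norm_num) (by norm_num)
    exact (mul_le_of_le_one_left (meanRate_nonneg (by positivity)) h2).trans h1

theorem isThroughput_medianCFP {Ω : Type*} [MeasurableSpace Ω] {μ : Measure Ω}
    [IsProbabilityMeasure μ] {X h : ℕ → Ω → ℝ} {δ : ℝ} (hδ : 0 < δ)
    (hXm : ∀ t, Measurable (X t))
    (hX : iIndepFun X μ) (hid : ∀ t, IdentDistrib (X t) (X 0) μ μ)
    (hmed : cdf (μ.map (X 0)) δ = 1 / 2) (hhm : ∀ t, Measurable (h t)) (hhi : iIndepFun h μ)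
    (hh : ∀ t, μ.map (h t) = expMeasure 1)
    (hXh : IndepFun (fun ω t => X t ω) (fun ω t => h t ω) μ) :
    IsThroughput μ (fun t ω => rate (h t ω) (medianCFP δ (fun s => X s ω) t))
      (∑' j : ℕ, (1 / 2 : ℝ) ^ (j + 1) * meanRate ((1 / 2) ^ (j + 1) * δ)) := by
  simp only [rate_medianCFP_eq hδ]
  have hint : ∀ t, Integrable (fun ω => ∑ j ∈ Finset.range (t + 1), gapRate δ X h j (t - j) ω) μ :=
    fun t => integrable_finsetSum _ fun j _ => integrable_gapRate hδ hXm hhm hh _ _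
  refine ⟨?_, hint, ?_⟩
  · filter_upwards [ae_gain_pos hhm hh, ae_tendsto_average_gain hhm hhi hh, ae_all_iff.2
      fun j => ae_tendsto_average_gapRate hδ hXm hX hid hmed hhm hhi hh hXh j] with ω h1 h2 h3
    have hb : Summable fun j : ℕ => (1 / 2 : ℝ) ^ (j + 1) * δ :=
      ((summable_nat_add_iff 1).2 summable_geometric_two).mul_right δ
    refine (tendsto_average_sum_range (V := fun j s => gapRate δ X h j s ω)
      (g := fun t => h t ω) (b := fun j => (1 / 2) ^ (j + 1) * δ) (fun t => (h1 t).le)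
      (fun j => by positivity) hb h2 (fun j s => ?_) h3).congr fun N => ?_
    · have h4 := gapIndicator_mem δ (fun i => X i ω) s j
      have hP : 0 ≤ (1 / 2 : ℝ) ^ (j + 1) * δ := by positivity
      have h5 := rate_nonneg (h1 (s + j)).le hP
      rw [gapRate, abs_of_nonneg (mul_nonneg h4.1 h5)]
      exact (mul_le_of_le_one_left h5 h4.2).trans (rate_le (h1 (s + j)).le hP)
    · rw [div_eq_mul_inv, mul_comm, one_div]
  · have h1 : ∀ t, ∫ ω, ∑ j ∈ Finset.range (t + 1), gapRate δ X h j (t - j) ω ∂μ =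
        ∑ j ∈ Finset.range (t + 1), (1 / 2 : ℝ) ^ (j + 1) * meanRate ((1 / 2) ^ (j + 1) * δ) :=
      fun t => by
        rw [integral_finsetSum _ fun j _ => integrable_gapRate hδ hXm hhm hh _ _]
        exact Finset.sum_congr rfl fun j _ => integral_gapRate hXm hX hid hmed hhm hh hXh _ _
    have h2 := (((summable_gap_meanRate hδ).hasSum.tendsto_sum_nat).comp
      (tendsto_add_atTop_nat 1)).cesaro
    refine h2.congr fun N => ?_
    rw [integral_const_mul, integral_finsetSum _ fun t _ => hint t, inv_eq_one_div]
    simp only [h1, Function.comp_apply]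

/-! ### The lower bound -/

/-- The throughput is within `1.42` bits of the rate of a unit channel used with energy `δ`:
`0.42` bits are lost to fading, and since `log (1 + c δ) ≥ log c + log (1 + δ)` for `c ≤ 1`, another
`∑ (j + 1) / 2 ^ (j + 2) = 1` bit to the geometric decay of the energy. -/
theorem le_tsum_gap_meanRate {δ : ℝ} (hδ : 0 < δ) :
    1 / 2 * Real.logb 2 (1 + δ) - 1.42 ≤
      ∑' j : ℕ, (1 / 2 : ℝ) ^ (j + 1) * meanRate ((1 / 2) ^ (j + 1) * δ) := by
  have hgeo : HasSum (fun j : ℕ => (1 / 2 : ℝ) ^ (j + 1)) 1 := by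
    have := hasSum_geometric_two.mul_right (1 / 2 : ℝ)
    norm_num [← pow_succ] at this
    simpa using this
  have hlin : HasSum (fun j : ℕ => (1 / 2 : ℝ) ^ (j + 1) * (j + 1)) 2 := by
    have h1 := hasSum_coe_mul_geometric_of_norm_lt_one (r := (1 / 2 : ℝ)) (by norm_num)
    have h2 := (hasSum_nat_add_iff' 1).2 h1
    norm_num at h2
    simpa only [mul_comm] using h2
  have hlow : HasSum (fun j : ℕ => (1 / 2 : ℝ) ^ (j + 1) * (1 / 2 * Real.logb 2 (1 + δ) - 0.42)
      - 1 / 2 * ((1 / 2 : ℝ) ^ (j + 1) * (j + 1))) (1 / 2 * Real.logb 2 (1 + δ) - 1.42) := by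
    have := (hgeo.mul_right (1 / 2 * Real.logb 2 (1 + δ) - 0.42)).sub (hlin.mul_left (1 / 2))
    rwa [show 1 * (1 / 2 * Real.logb 2 (1 + δ) - 0.42) - 1 / 2 * 2 =
      1 / 2 * Real.logb 2 (1 + δ) - 1.42 by ring] at this
  refine hasSum_le (fun j => ?_) hlow (summable_gap_meanRate hδ).hasSum
  have hc0 : (0 : ℝ) < (1 / 2) ^ (j + 1) := by positivity
  have hc1 : (1 / 2 : ℝ) ^ (j + 1) ≤ 1 := pow_le_one₀ (by norm_num) (by norm_num)
  have h1 := le_meanRate (P := (1 / 2) ^ (j + 1) * δ) (by positivity)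
  have h2 : Real.logb 2 ((1 / 2 : ℝ) ^ (j + 1)) = -(j + 1) := by
    rw [one_div, inv_pow, Real.logb_inv, Real.logb_pow, Real.logb_self_eq_one (by norm_num)]
    push_cast
    ring
  have h3 : -(j + 1 : ℝ) + Real.logb 2 (1 + δ) ≤ Real.logb 2 (1 + (1 / 2) ^ (j + 1) * δ) := by
    rw [← h2, ← Real.logb_mul hc0.ne' (by linarith)]
    refine Real.logb_le_logb_of_le (by norm_num) (by positivity) ?_
    linarith
  calc (1 / 2 : ℝ) ^ (j + 1) * (1 / 2 * Real.logb 2 (1 + δ) - 0.42)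
        - 1 / 2 * ((1 / 2 : ℝ) ^ (j + 1) * (j + 1))
      = (1 / 2 : ℝ) ^ (j + 1) * (1 / 2 * (-(j + 1 : ℝ) + Real.logb 2 (1 + δ)) - 0.42) := by ring
    _ ≤ (1 / 2 : ℝ) ^ (j + 1) * meanRate ((1 / 2) ^ (j + 1) * δ) := by gcongr; linarith

/-- Chebyshev's inequality at the median. -/
theorem sq_median_le {Ω : Type*} [MeasurableSpace Ω] {μ : Measure Ω} [IsProbabilityMeasure μ]
    {Y : Ω → ℝ} (hY : Measurable Y) (hsq : Integrable (fun ω => Y ω ^ 2) μ) {δ : ℝ} (hδ : 0 < δ)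
    (hmed : cdf (μ.map Y) δ = 1 / 2) : δ ^ 2 ≤ 2 * ∫ ω, Y ω ^ 2 ∂μ := by
  have hle := (measureReal_preimage_Iic hY δ).trans hmed
  have hgt : μ.real (Y ⁻¹' Set.Iic δ)ᶜ = 1 / 2 := by
    rw [probReal_compl_eq_one_sub (hY measurableSet_Iic), hle]; norm_num
  have hmono : μ.real (Y ⁻¹' Set.Iic δ)ᶜ ≤ μ.real {ω | δ ^ 2 ≤ Y ω ^ 2} := by
    refine measureReal_mono fun ω hω => ?_
    have : δ < Y ω := by simpa using hω
    exact pow_le_pow_left₀ hδ.le this.le 2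
  have hmar := mul_meas_ge_le_integral_of_nonneg
    (Eventually.of_forall fun ω => sq_nonneg (Y ω)) hsq (δ ^ 2)
  rw [hgt] at hmono
  nlinarith [sq_nonneg δ]

/-- Since `√2 √M ≥ δ`, replacing `√2 √M` by `δ` in `T_ub` costs at most the logarithmic term of the
bound, less a quarter of a bit: `(1 + u) / u ≤ (1 + δ) / δ` for `u ≥ δ`. -/
theorem throughputUB_le {M δ : ℝ} (hδ : 0 < δ) (hM : δ ^ 2 ≤ 2 * M) :
    throughputUB M - 1 / 4 * Real.logb 2 (M / δ ^ 2) ≤ 1 / 2 * Real.logb 2 (1 + δ) + 0.25 := by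
  have hM0 : 0 < M := by nlinarith [pow_pos hδ 2]
  obtain ⟨u, hu⟩ : ∃ u, u = √2 * √M := ⟨_, rfl⟩
  have hu0 : 0 < u := by rw [hu]; positivity
  have husq : u ^ 2 = 2 * M := by
    rw [hu, mul_pow, Real.sq_sqrt (by norm_num), Real.sq_sqrt hM0.le]
  have hδu : δ ≤ u := by
    refine le_of_sq_le_sq ?_ hu0.le
    rw [husq]; exact hM
  have h1 : Real.logb 2 (M / δ ^ 2) = 2 * Real.logb 2 u - 2 * Real.logb 2 δ - 1 := by
    rw [show M / δ ^ 2 = u ^ 2 / δ ^ 2 / 2 by rw [husq]; field_simp,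
      Real.logb_div (by positivity) (by norm_num), Real.logb_div (by positivity) (by positivity),
      Real.logb_pow, Real.logb_pow, Real.logb_self_eq_one (by norm_num)]
    push_cast
    ring
  have h2 : Real.logb 2 (1 + u) + Real.logb 2 δ ≤ Real.logb 2 (1 + δ) + Real.logb 2 u := by
    rw [← Real.logb_mul (by positivity) hδ.ne', ← Real.logb_mul (by positivity) hu0.ne']
    refine Real.logb_le_logb_of_le (by norm_num) (by positivity) ?_
    nlinarith
  rw [throughputUB, ← hu, h1]
  linarith

end EnergyHarvesting

theorem theorem2 {Ω : Type*} [MeasurableSpace Ω] (μ : Measure Ω) [IsProbabilityMeasure μ]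
    (X h : ℕ → Ω → ℝ)
    -- the energy arrivals: i.i.d., nonnegative, with finite second moment
    (hX_meas : ∀ t, Measurable (X t))
    (hX_indep : iIndepFun X μ)
    (hX_ident : ∀ t, IdentDistrib (X t) (X 0) μ μ)
    (hX_nonneg : ∀ t, ∀ᵐ ω ∂μ, 0 ≤ X t ω)
    (hX_sq : Integrable (fun ω => X 0 ω ^ 2) μ)
    -- the channel gains: i.i.d. exponential with mean one, independent of the arrivals
    (hh_meas : ∀ t, Measurable (h t))
    (hh_indep : iIndepFun h μ)
    (hh_law : ∀ t, μ.map (h t) = expMeasure 1)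
    (hXh : IndepFun (fun ω t => X t ω) (fun ω t => h t ω) μ)
    -- battery size, initial charge, and median
    (Bmax b₀ δ : ℝ) (hb₀ : 0 ≤ b₀) (hb₀' : b₀ ≤ Bmax)
    (hδ : 0 < δ) (hδB : δ ≤ Bmax) (hmed : cdf (μ.map (X 0)) δ = 1 / 2) :
    -- the policy is feasible, also if only the packets of size `δ` are stored
    (∀ᵐ ω ∂μ,
      EnergyHarvesting.EnergyNeutral Bmax b₀ (fun t => X t ω)
        (EnergyHarvesting.medianCFP δ (fun t => X t ω)) ∧
      EnergyHarvesting.EnergyNeutral Bmax b₀ (fun t => EnergyHarvesting.packet δ (X t ω))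
        (EnergyHarvesting.medianCFP δ (fun t => X t ω))) ∧
    -- its throughput exists and satisfies the bound
    ∃ Tlb : ℝ,
      EnergyHarvesting.IsThroughput μ
        (fun t ω => EnergyHarvesting.rate (h t ω)
          (EnergyHarvesting.medianCFP δ (fun s => X s ω) t)) Tlb ∧
      Tlb ≥ EnergyHarvesting.throughputUB (∫ ω, X 0 ω ^ 2 ∂μ) - 1.67
        - 1 / 4 * Real.logb 2 ((∫ ω, X 0 ω ^ 2 ∂μ) / δ ^ 2) := by
  refine ⟨?_, _, EnergyHarvesting.isThroughput_medianCFP hδ hX_meas hX_indep hX_ident hmed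
    hh_meas hh_indep hh_law hXh, ?_⟩
  · filter_upwards [ae_all_iff.2 hX_nonneg] with ω hω
    refine ⟨EnergyHarvesting.energyNeutral_medianCFP hb₀ hδ hδB fun t => ?_,
      EnergyHarvesting.energyNeutral_medianCFP hb₀ hδ hδB fun t => le_rfl⟩
    unfold EnergyHarvesting.packet
    split_ifs with h1
    · exact h1.le
    · exact hω t
  · have h1 := EnergyHarvesting.le_tsum_gap_meanRate hδ
    have h2 := EnergyHarvesting.throughputUB_le hδ
      (EnergyHarvesting.sq_median_le (hX_meas 0) hX_sq hδ hmed)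
    linarith
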